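/- Let $\mathbb F_q$ be a finite field with $q$ elements, let $K_\infty=\mathbb F_q((1/\theta))$ with the absolute value normalised by $|\theta|_\infty=q$, let $\mathbb C_\infty$ be the completion of an algebraic closure of $K_\infty$, and let $\mathbb T\subset\mathbb C_\infty[[t]]$ be the Tate algebra of power series $\sum_i a_it^i$ with $a_i\to 0$. For $f=\sum_i a_it^i$ put $f^{(1)}=\sum_i a_i^qt^i$ and $\wp(f)=f-f^{(1)}$. Fix a $(q-1)$-th root $\xi$ of $-\theta$ and let $$\Omega=\xi^{-q}\prod_{i\ge 1}\Bigl(1-\frac{t}{\theta^{q^i}}\Bigr)\in\mathbb T^\times .$$ **Solutions.** For $Y_1,\dots,Y_k\in\mathbb T$, the symbols $\mathfrak{Li}^o(Y_i,\dots,Y_k)\in\mathbb T$ ($1\le i\le k$) denote any solution of $$\wp\bigl(\mathfrak{Li}^o(Y_i,\dots,Y_k)\bigr)=Y_i\cdot\mathfrak{Li}^o(Y_{i+1},\dots,Y_k)^{(1)},\qquad 1\le i\le k,$$ and $\mathfrak{Li}^{\star,o}(Y_i,\dots,Y_k)\in\mathbb T$ any solution of $$\wp\bigl(\mathfrak{Li}^{\star,o}(Y_i,\dots,Y_k)\bigr)=Y_i\cdot\mathfrak{Li}^{\star,o}(Y_{i+1},\dots,Y_k),\qquad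 1\le i\le k,$$ where the symbol with no argument is $1$. **Branches.** Let $d\ge1$, let $n_1,\dots,n_d\ge 1$ be integers, $N=n_1+\cdots+n_d$, let $Z_1,\dots,Z_d\in\mathbb T$ and $Y_i=\Omega^{n_i}Z_i$. Let $\mathbb M_{n_1,\dots,n_d}^{Z_1,\dots,Z_{d-1}}\subset\mathbb T^d$ be $\Omega^{-N}$ times the $\mathbb F_q[t]$-module generated by the vectors $$\bigl(\{0\}^{d-k-1},1,\mathfrak{Li}^o(Y_k),\mathfrak{Li}^o(Y_{k-1},Y_k),\dots,\mathfrak{Li}^o(Y_1,\dots,Y_k)\bigr),\qquad 0\le k\le d-1,$$ and let $\mathbb M_{n_1,\dots,n_d}^{\star,Z_1,\dots,Z_{d-1}}\subset\mathbb T^d$ be $\Omega^{-N}$ times the one generated by $$\bigl(\mathfrak{Li}^{\star,o}(Y_1,\dots,Y_k),\dots,\mathfrak{Li}^{\star,o}(Y_k),1,\{0\}^{d-k-1}\bigr),\qquad 0\le k\le d-1$$ (these modules do not depend on the chosen solutions). With $Z_1,\dots,Z_{d-1}$ fixed, a *branch* $\vec{\mathfrak{Li}}^{o}_{n_1,\dots,n_d}(Z_1,\dots,Z_{d-1},-):\mathbb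 T\to\mathbb T^d$ of the $t$-motivic Carlitz multiple polylogarithm is an $\mathbb F_q$-linear map whose value at each $Z_d\in\mathbb T$ is congruent modulo $\mathbb M_{n_1,\dots,n_d}^{Z_1,\dots,Z_{d-1}}$ to $$\Omega^{-N}\bigl(\mathfrak{Li}^o(Y_d),\mathfrak{Li}^o(Y_{d-1},Y_d),\dots,\mathfrak{Li}^o(Y_1,\dots,Y_d)\bigr)^{\mathtt T}.$$ A *branch* $\vec{\mathfrak{Li}}^{\star,o}_{n_1,\dots,n_d}(Z_1,\dots,Z_{d-1},-):\mathbb T\to\mathbb T^d$ of the $t$-motivic Carlitz multiple star polylogarithm is an $\mathbb F_q$-linear map whose value at each $Z_d\in\mathbb T$ is congruent modulo $\mathbb M_{n_1,\dots,n_d}^{\star,Z_1,\dots,Z_{d-1}}$ to $$\Omega^{-N}\bigl(\mathfrak{Li}^{\star,o}(Y_1,\dots,Y_d),\mathfrak{Li}^{\star,o}(Y_2,\dots,Y_d),\dots,\mathfrak{Li}^{\star,o}(Y_d)\bigr)^{\mathtt T}.$$ **Theorem.** Let $d\ge 1$, let $n_1,\dots,n_d\ge1$ be integers, $N=n_1+\cdots+n_d$,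 and let $Z_1,\dots,Z_d\in\mathbb T$. For any branches $\vec{\mathfrak{Li}}_{n_1,\dots,n_d}^{o}(Z_1,\dots,Z_{d-1},-)$ and $\vec{\mathfrak{Li}}_{n_d,\dots,n_1}^{\star,o}(Z_d,\dots,Z_2,-)$, with values $\vec{\mathfrak{Li}}_{n_1,\dots,n_d}^{o}(Z_1,\dots,Z_d)\in\mathbb T^d$ at $Z_d$ and $\vec{\mathfrak{Li}}_{n_d,\dots,n_1}^{\star,o}(Z_d,\dots,Z_1)\in\mathbb T^d$ at $Z_1$, we have $$ \begin{pmatrix}\vec{\mathfrak{Li}}_{n_d,\dots,n_1}^{\star,o}(-Z_d,\dots,-Z_1)\\ \Omega^{-N}\end{pmatrix}^{\mathtt T}\cdot \begin{pmatrix}\Omega^{-N}\\ \vec{\mathfrak{Li}}_{n_1,\dots,n_d}^{o}(Z_1,\dots,Z_d)\end{pmatrix} \equiv 0 \pmod{\mathbb F_q[[t]]\cdot\Omega^{-2N}}, $$ where $\vec{\mathfrak{Li}}_{n_d,\dots,n_1}^{\star,o}(-Z_d,\dots,-Z_1)$ is the vector obtained from $\vec{\mathfrak{Li}}_{n_d,\dots,n_1}^{\star,o}(Z_d,\dots,Z_1)$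 by multiplying its $j$-th coordinate (the one built from the $d+1-j$ arguments $Z_{d+1-j},\dots,Z_1$) by $(-1)^{d+1-j}$, for $1\le j\le d$. -/

import Mathlib

noncomputable section

namespace CarlitzMPL

open Filter Topology PowerSeries
open scoped NNReal WithZero Polynomial Pointwise

section Field

variable (Fq : Type*) [Field Fq] [Fintype Fq]

/-- The number `q` of elements of the finite field. -/
abbrev card : ℕ := Fintype.card Fq

/-- `K_∞ = 𝔽_q((1/θ))`: the variable of the Laurent series field is `1/θ`. -/
abbrev KInfty : Type _ := LaurentSeries Fq

/-- The element `θ` of `K_∞ = 𝔽_q((1/θ))`. -/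
def thetaK : KInfty Fq := HahnSeries.single (-1) 1

theorem one_lt_card : (1 : ℝ≥0) < (card Fq : ℝ≥0) := by
  exact_mod_cast Fintype.one_lt_card

/-- The absolute value on `K_∞` is `q ^ (-ord)`, normalised by `|θ| = q`. -/
instance rankOne : (Valued.v : Valuation (KInfty Fq) ℤᵐ⁰).RankOne where
  hom' := (WithZeroMulInt.toNNReal (one_lt_card Fq).ne_zero).comp
    MonoidWithZeroHom.ValueGroup₀.embedding
  strictMono' := (WithZeroMulInt.toNNReal_strictMono (one_lt_card Fq)).comp
    MonoidWithZeroHom.ValueGroup₀.embedding_strictMono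
  exists_val_nontrivial := by
    obtain ⟨x, hx⟩ := LaurentSeries.valuation_surjective Fq (WithZero.exp 1)
    refine ⟨x, ?_, ?_⟩ <;> rw [hx] <;> simp

instance normedFieldK : NormedField (KInfty Fq) := Valued.toNormedField (KInfty Fq) ℤᵐ⁰

theorem norm_thetaK : ‖thetaK Fq‖ = card Fq := by
  have h : (Valued.v (thetaK Fq) : ℤᵐ⁰) = WithZero.exp 1 := by
    rw [thetaK, LaurentSeries.valuation_single_zpow]; simp
  have h2 : ‖thetaK Fq‖ = ((WithZeroMulInt.toNNReal (one_lt_card Fq).ne_zero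
      (MonoidWithZeroHom.ValueGroup₀.embedding (Valued.v.restrict (thetaK Fq))) : ℝ≥0) : ℝ) := rfl
  rw [h2, Valuation.embedding_restrict, h]
  rw [WithZeroMulInt.toNNReal_neg_apply _ WithZero.exp_ne_zero]
  simp [WithZero.exp]

instance nontriviallyNormedFieldK : NontriviallyNormedField (KInfty Fq) where
  non_trivial := ⟨thetaK Fq, by
    rw [norm_thetaK]; exact_mod_cast Fintype.one_lt_card (α := Fq)⟩

instance isUltrametricDistK : IsUltrametricDist (KInfty Fq) :=
  IsUltrametricDist.isUltrametricDist_of_forall_norm_add_le_max_norm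
    (Valued.isNonarchimedean_norm (KInfty Fq) ℤᵐ⁰)

/-- The algebraic closure of `K_∞`, with the unique extension of the absolute value. -/
abbrev KBar : Type _ := AlgebraicClosure (KInfty Fq)

instance normedFieldKBar : NormedField (KBar Fq) := spectralNorm.normedField (KInfty Fq) (KBar Fq)

instance isUltrametricDistKBar : IsUltrametricDist (KBar Fq) :=
  IsUltrametricDist.isUltrametricDist_of_forall_norm_add_le_max_norm
    (isNonarchimedean_spectralNorm (K := KInfty Fq) (L := KBar Fq))

instance uniformContinuousConstSMulKBar : UniformContinuousConstSMul Fq (KBar Fq) where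
  uniformContinuous_const_smul c := by
    simp only [Algebra.smul_def]
    exact uniformContinuous_const_smul (M := KBar Fq) (X := KBar Fq) (algebraMap Fq (KBar Fq) c)

/-- `ℂ_∞`, the completion of the algebraic closure of `K_∞`. -/
abbrev CInfty : Type _ := UniformSpace.Completion (KBar Fq)

instance isUltrametricDistC : IsUltrametricDist (CInfty Fq) :=
  IsUltrametricDist.isUltrametricDist_of_forall_norm_add_le_max_norm fun x y => by
    induction x, y using UniformSpace.Completion.induction_on₂ with
    | hp => exact isClosed_le (by fun_prop) (by fun_prop)
    | ih x y =>
      rw [← UniformSpace.Completion.coe_add]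
      simp only [UniformSpace.Completion.norm_coe]
      exact IsUltrametricDist.norm_add_le_max x y

/-- The element `θ` of `ℂ_∞`. -/
def theta : CInfty Fq := ((algebraMap (KInfty Fq) (KBar Fq) (thetaK Fq) : KBar Fq) : CInfty Fq)

end Field

section Tate

variable (Fq : Type*) [Field Fq] [Fintype Fq]

/-- The Tate algebra `𝕋 ⊆ ℂ_∞⟦t⟧` of power series whose coefficients tend to zero, as an
`𝔽_q[t]`-algebra. -/
def tate : Subalgebra Fq[X] (CInfty Fq)⟦X⟧ where
  carrier := {f | Tendsto (fun i => ‖coeff i f‖) atTop (𝓝 0)}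
  mul_mem' {f g} hf hg := by
    have := PowerSeries.isRestricted.mul (R := CInfty Fq) 1 (f := f) (g := g)
      (by simpa [PowerSeries.isRestricted_iff'] using hf)
      (by simpa [PowerSeries.isRestricted_iff'] using hg)
    simpa [PowerSeries.isRestricted_iff'] using this
  add_mem' {f g} hf hg := by
    have := PowerSeries.isRestricted.add (R := CInfty Fq) 1 (f := f) (g := g)
      (by simpa [PowerSeries.isRestricted_iff'] using hf)
      (by simpa [PowerSeries.isRestricted_iff'] using hg)
    simpa [PowerSeries.isRestricted_iff'] using this
  algebraMap_mem' p := by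
    refine tendsto_const_nhds.congr' ?_
    filter_upwards [eventually_gt_atTop p.natDegree] with i hi
    simp [PowerSeries.algebraMap_apply', Polynomial.coeff_eq_zero_of_natDegree_lt hi]

variable {Fq}

/-- The Frobenius twist `f = ∑ aᵢ tⁱ ↦ f⁽¹⁾ = ∑ aᵢ^q tⁱ`. -/
def twist (f : (CInfty Fq)⟦X⟧) : (CInfty Fq)⟦X⟧ :=
  PowerSeries.mk fun i => coeff i f ^ card Fq

/-- The Artin–Schreier operator `℘(f) = f - f⁽¹⁾`. -/
def wp (f : (CInfty Fq)⟦X⟧) : (CInfty Fq)⟦X⟧ := f - twist f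

open scoped PowerSeries.WithPiTopology in
/-- `Ω = (-θ)^(-q/(q-1)) ∏_{i ≥ 1} (1 - t / θ^(q^i))`, where `ξ` is the chosen `(q-1)`-th root
of `-θ`, so that `(-θ)^(-q/(q-1)) = ξ^(-q)`. The product converges coefficientwise. -/
def Omega (ξ : CInfty Fq) : (CInfty Fq)⟦X⟧ :=
  C ((ξ ^ card Fq)⁻¹) * ∏' i : ℕ, (1 - C ((theta Fq ^ card Fq ^ (i + 1))⁻¹) * X)

end Tate

section Polylog

variable {Fq : Type*} [Field Fq] [Fintype Fq]

/-- `L = (1, 𝔏𝔦ᵒ_{0}(Y_k), 𝔏𝔦ᵒ_{0,0}(Y_{k-1}, Y_k), …, 𝔏𝔦ᵒ_{0,…,0}(Y_1, …, Y_k))` is a solution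
in `𝕋` of the system
`℘(𝔏𝔦_{{0}^i}(Y_{k-i+1}, …, Y_k)) = Y_{k-i+1} · 𝔏𝔦_{{0}^{i-1}}(Y_{k-i+2}, …, Y_k)⁽¹⁾`, `1 ≤ i ≤ k`,
with `𝔏𝔦_{{0}^0} = 1`; the entry `L i` has depth `i`. -/
def IsLiSolution {k : ℕ} (Y : Fin k → (CInfty Fq)⟦X⟧) (L : Fin (k + 1) → (CInfty Fq)⟦X⟧) : Prop :=
  (∀ i, L i ∈ tate Fq) ∧ L 0 = 1 ∧
    ∀ i : Fin k, wp (L i.succ) = Y i.rev * twist (L i.castSucc)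

/-- `S = (𝔏𝔦^{⋆,o}_{0,…,0}(Y_1, …, Y_k), …, 𝔏𝔦^{⋆,o}_{0}(Y_k), 1)` is a solution in `𝕋` of the
star system
`℘(𝔏𝔦⋆_{{0}^i}(Y_{k-i+1}, …, Y_k)) = Y_{k-i+1} · 𝔏𝔦⋆_{{0}^{i-1}}(Y_{k-i+2}, …, Y_k)`, `1 ≤ i ≤ k`,
with `𝔏𝔦⋆_{{0}^0} = 1`; the entry `S i` has depth `k - i`. -/
def IsStarSolution {k : ℕ} (Y : Fin k → (CInfty Fq)⟦X⟧) (S : Fin (k + 1) → (CInfty Fq)⟦X⟧) :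
    Prop :=
  (∀ i, S i ∈ tate Fq) ∧ S (Fin.last k) = 1 ∧
    ∀ i : Fin k, wp (S i.castSucc) = Y i * S i.succ

/-- The monodromy module `𝕄_{{0}^{d+1}}^{Y_1, …, Y_d}`: the `𝔽_q[t]`-module generated by the vectors
`(0, …, 0, 1, 𝔏𝔦ᵒ(Y_k), …, 𝔏𝔦ᵒ(Y_1, …, Y_k))` of length `d + 1`, for `0 ≤ k ≤ d`. All choices of
the solutions are admitted as generators; any single choice generates the same module. -/
def monodromyZero {d : ℕ} (Y : Fin d → (CInfty Fq)⟦X⟧) :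
    Submodule Fq[X] (Fin (d + 1) → (CInfty Fq)⟦X⟧) :=
  Submodule.span Fq[X] {v | ∃ (k : ℕ) (hk : k ≤ d) (L : Fin (k + 1) → (CInfty Fq)⟦X⟧),
    IsLiSolution (fun i => Y (Fin.castLE hk i)) L ∧
    v = fun j : Fin (d + 1) => if _h : d - k ≤ (j : ℕ) then L ⟨j - (d - k), by omega⟩ else 0}

/-- The star monodromy module `𝕄_{{0}^{d+1}}^{⋆, Y_1, …, Y_d}`: the `𝔽_q[t]`-module generated by
`(𝔏𝔦^{⋆,o}(Y_1, …, Y_k), …, 𝔏𝔦^{⋆,o}(Y_k), 1, 0, …, 0)`, for `0 ≤ k ≤ d`. -/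
def monodromyZeroStar {d : ℕ} (Y : Fin d → (CInfty Fq)⟦X⟧) :
    Submodule Fq[X] (Fin (d + 1) → (CInfty Fq)⟦X⟧) :=
  Submodule.span Fq[X] {v | ∃ (k : ℕ) (hk : k ≤ d) (S : Fin (k + 1) → (CInfty Fq)⟦X⟧),
    IsStarSolution (fun i => Y (Fin.castLE hk i)) S ∧
    v = fun j : Fin (d + 1) => if _h : (j : ℕ) ≤ k then S ⟨j, by omega⟩ else 0}

/-- `𝕄_{n_1, …, n_{d+1}}^{Z_1, …, Z_d}`
`= Ω^(-n_1-⋯-n_{d+1}) 𝕄_{{0}^{d+1}}^{Ω^{n_1} Z_1, …, Ω^{n_d} Z_d}`. -/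
def monodromy (ξ : CInfty Fq) {d : ℕ} (n : Fin (d + 1) → ℕ) (Z : Fin d → tate Fq) :
    Submodule Fq[X] (Fin (d + 1) → (CInfty Fq)⟦X⟧) :=
  (Omega ξ)⁻¹ ^ (∑ i, n i) • monodromyZero fun i => Omega ξ ^ n i.castSucc * (Z i : (CInfty Fq)⟦X⟧)

/-- `𝕄_{n_1, …, n_{d+1}}^{⋆, Z_1, …, Z_d}`
`= Ω^(-n_1-⋯-n_{d+1}) 𝕄_{{0}^{d+1}}^{⋆, Ω^{n_1} Z_1, …, Ω^{n_d} Z_d}`. -/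
def monodromyStar (ξ : CInfty Fq) {d : ℕ} (n : Fin (d + 1) → ℕ) (Z : Fin d → tate Fq) :
    Submodule Fq[X] (Fin (d + 1) → (CInfty Fq)⟦X⟧) :=
  (Omega ξ)⁻¹ ^ (∑ i, n i) •
    monodromyZeroStar fun i => Omega ξ ^ n i.castSucc * (Z i : (CInfty Fq)⟦X⟧)

/-- `B` is a branch `𝕋 → 𝕋^{d+1}` of the `t`-motivic CMPL with the first `d` arguments `Z` fixed:
an `𝔽_q`-linear map such that, for every `z`, the class of `B z` modulo
`𝕄_{n_1, …, n_{d+1}}^{Z_1, …, Z_d}` is that of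
`Ω^(-n_1-⋯-n_{d+1}) (𝔏𝔦ᵒ(Y_{d+1}), 𝔏𝔦ᵒ(Y_d, Y_{d+1}), …, 𝔏𝔦ᵒ(Y_1, …, Y_{d+1}))`, where
`Y_i = Ω^{n_i} Z_i` and `Z_{d+1} = z`. This class does not depend on the solution. -/
def IsBranch (ξ : CInfty Fq) {d : ℕ} (n : Fin (d + 1) → ℕ) (Z : Fin d → tate Fq)
    (B : tate Fq →ₗ[Fq] (Fin (d + 1) → tate Fq)) : Prop :=
  ∀ z : tate Fq, ∃ L : Fin (d + 2) → (CInfty Fq)⟦X⟧,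
    IsLiSolution (fun i => Omega ξ ^ n i *
      ((Fin.snoc (α := fun _ => tate Fq) Z z i : tate Fq) : (CInfty Fq)⟦X⟧)) L ∧
    (fun j => (B z j : (CInfty Fq)⟦X⟧)) ≡
      (Omega ξ)⁻¹ ^ (∑ i, n i) • (fun j : Fin (d + 1) => L j.succ) [SMOD monodromy ξ n Z]

/-- `B` is a branch `𝕋 → 𝕋^{d+1}` of the `t`-motivic CMSPL with the first `d` arguments `Z` fixed:
an `𝔽_q`-linear map such that, for every `z`, the class of `B z` modulo
`𝕄_{n_1, …, n_{d+1}}^{⋆, Z_1, …, Z_d}` is that of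
`Ω^(-n_1-⋯-n_{d+1}) (𝔏𝔦^{⋆,o}(Y_1, …, Y_{d+1}), 𝔏𝔦^{⋆,o}(Y_2, …, Y_{d+1}), …, 𝔏𝔦^{⋆,o}(Y_{d+1}))`,
where `Y_i = Ω^{n_i} Z_i` and `Z_{d+1} = z`. -/
def IsStarBranch (ξ : CInfty Fq) {d : ℕ} (n : Fin (d + 1) → ℕ) (Z : Fin d → tate Fq)
    (B : tate Fq →ₗ[Fq] (Fin (d + 1) → tate Fq)) : Prop :=
  ∀ z : tate Fq, ∃ S : Fin (d + 2) → (CInfty Fq)⟦X⟧,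
    IsStarSolution (fun i => Omega ξ ^ n i *
      ((Fin.snoc (α := fun _ => tate Fq) Z z i : tate Fq) : (CInfty Fq)⟦X⟧)) S ∧
    (fun j => (B z j : (CInfty Fq)⟦X⟧)) ≡
      (Omega ξ)⁻¹ ^ (∑ i, n i) • (fun j : Fin (d + 1) => S j.castSucc) [SMOD monodromyStar ξ n Z]

/-- The star vector with its arguments negated: the entry of depth `i` is multiplied by `(-1)^i`.
The entry with index `j` (counted from `0`) has depth `d + 1 - j`. -/
def negateArgs {d : ℕ} (v : Fin (d + 1) → tate Fq) : Fin (d + 1) → (CInfty Fq)⟦X⟧ :=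
  fun j => (-1) ^ (d + 1 - (j : ℕ)) * (v j : (CInfty Fq)⟦X⟧)

end Polylog

end CarlitzMPL

end

open CarlitzMPL PowerSeries

/-! Up to the factor `Ω^(-N)`, the two vectors, completed by the entry `1`, are solutions `V` and
`W` of two mutually adjoint difference systems, the second with the `Y_i` in reverse order. The
values of a branch are only known modulo monodromy, but monodromy vectors padded by one `0` solve
the same systems with the constant entry `1` replaced by one that `℘` kills, so `V` and `W` may
absorb them. The sum `∑ (-1)^(k-j) W_j V_j` is fixed by the twist (`twist_sum_mul_eq`), so its
coefficients lie in `𝔽_q` (`exists_algebraMap_eq_of_twist_eq`). Restoring `Ω^(-N)` on each side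
gives an element of `𝔽_q⟦t⟧ · Ω^(-2N)`. -/

namespace CarlitzMPL

open Polynomial

/-! ### The Frobenius twist and its fixed points. -/

section Twist

variable {Fq : Type*} [Field Fq] [Fintype Fq]

/-- The Frobenius twist as a ring homomorphism. -/
noncomputable def twistHom : (CInfty Fq)⟦X⟧ →+* (CInfty Fq)⟦X⟧ :=
  PowerSeries.map (FiniteField.frobeniusAlgHom Fq (CInfty Fq) : CInfty Fq →+* CInfty Fq)

theorem twist_eq_twistHom (f : (CInfty Fq)⟦X⟧) : twist f = twistHom f := by
  ext i
  simp [twist, twistHom]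

/-- The coefficients of `p` lie in `𝔽_q`, where the `q`-Frobenius is trivial. This linearity makes
the solution sets below `𝔽_q[t]`-modules. -/
theorem twistHom_smul (p : Fq[X]) (f : (CInfty Fq)⟦X⟧) : twistHom (p • f) = p • twistHom f := by
  simp only [Algebra.smul_def, map_mul]
  congr 1
  ext i
  simp [twistHom, PowerSeries.algebraMap_apply']

/-- In a domain, `x^q - x = ∏ (x - a)` over `a ∈ 𝔽_q` vanishes only if some factor does. -/
theorem exists_algebraMap_eq_of_pow_card_eq {A : Type*} [CommRing A] [IsDomain A] [Algebra Fq A]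
    {x : A} (hx : x ^ Fintype.card Fq = x) : ∃ a : Fq, algebraMap Fq A a = x := by
  classical
  have h : (∏ a : Fq, (Polynomial.X - Polynomial.C a)) =
      (Polynomial.X ^ Fintype.card Fq - Polynomial.X : Fq[X]) := by
    have hmonic : (Polynomial.X ^ Fintype.card Fq - Polynomial.X : Fq[X]).Monic := by
      refine (Polynomial.monic_X_pow _).sub_of_left ?_
      rw [Polynomial.degree_X_pow, Polynomial.degree_X]
      exact_mod_cast Fintype.one_lt_card
    have := Polynomial.prod_multiset_X_sub_C_of_monic_of_roots_card_eq hmonic (by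
      rw [FiniteField.roots_X_pow_card_sub_X,
        FiniteField.X_pow_card_sub_X_natDegree_eq _ Fintype.one_lt_card]
      rfl)
    rwa [FiniteField.roots_X_pow_card_sub_X] at this
  have h2 := congrArg (Polynomial.aeval x) h
  simp only [map_prod, map_sub, map_pow, Polynomial.aeval_X, Polynomial.aeval_C, hx, sub_self,
    Finset.prod_eq_zero_iff] at h2
  obtain ⟨a, -, ha⟩ := h2
  exact ⟨a, (sub_eq_zero.1 ha).symm⟩

/-- The power series fixed by the Frobenius twist are those with coefficients in `𝔽_q`. -/
theorem exists_algebraMap_eq_of_twist_eq {f : (CInfty Fq)⟦X⟧} (hf : twist f = f) :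
    ∃ g : Fq⟦X⟧, algebraMap Fq⟦X⟧ (CInfty Fq)⟦X⟧ g = f := by
  have h (i : ℕ) : ∃ a : Fq, algebraMap Fq (CInfty Fq) a = PowerSeries.coeff i f := by
    apply exists_algebraMap_eq_of_pow_card_eq
    simpa [twist] using congrArg (PowerSeries.coeff i) hf
  choose g hg using h
  refine ⟨PowerSeries.mk g, ?_⟩
  ext i
  simp [PowerSeries.algebraMap_apply'', hg]

end Twist

/-! ### The two homogeneous systems, their monodromy solutions and their pairing. -/

section Systems

variable {Fq : Type*} [Field Fq] [Fintype Fq]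

/-- The solutions of the homogeneous system `℘(V_0) = 0`, `℘(V_i) = Y_{k-i+1} V_{i-1}⁽¹⁾`. -/
noncomputable def liSystem {k : ℕ} (Y : Fin k → (CInfty Fq)⟦X⟧) :
    Submodule Fq[X] (Fin (k + 1) → (CInfty Fq)⟦X⟧) where
  carrier := {V | wp (V 0) = 0 ∧ ∀ i : Fin k, wp (V i.succ) = Y i.rev * twist (V i.castSucc)}
  zero_mem' := by simp [wp, twist_eq_twistHom]
  add_mem' {V W} hV hW := by
    simp only [wp, twist_eq_twistHom, Set.mem_ofPred_eq, Pi.add_apply, map_add] at hV hW ⊢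
    exact ⟨by linear_combination hV.1 + hW.1, fun i => by linear_combination hV.2 i + hW.2 i⟩
  smul_mem' p V hV := by
    simp only [wp, twist_eq_twistHom, Set.mem_ofPred_eq, Pi.smul_apply, twistHom_smul] at hV ⊢
    simp only [← smul_sub, mul_smul_comm, hV, smul_zero, implies_true, and_self]

/-- The solutions of the homogeneous star system `℘(W_k) = 0`, `℘(W_i) = Y_{i+1} W_{i+1}`. -/
noncomputable def starSystem {k : ℕ} (Y : Fin k → (CInfty Fq)⟦X⟧) :
    Submodule Fq[X] (Fin (k + 1) → (CInfty Fq)⟦X⟧) where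
  carrier := {W | wp (W (Fin.last k)) = 0 ∧ ∀ i : Fin k, wp (W i.castSucc) = Y i * W i.succ}
  zero_mem' := by simp [wp, twist_eq_twistHom]
  add_mem' {V W} hV hW := by
    simp only [wp, twist_eq_twistHom, Set.mem_ofPred_eq, Pi.add_apply, map_add] at hV hW ⊢
    exact ⟨by linear_combination hV.1 + hW.1, fun i => by linear_combination hV.2 i + hW.2 i⟩
  smul_mem' p V hV := by
    simp only [wp, twist_eq_twistHom, Set.mem_ofPred_eq, Pi.smul_apply, twistHom_smul] at hV ⊢
    simp only [← smul_sub, mul_smul_comm, hV, smul_zero, implies_true, and_self]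

theorem wp_zero : wp (0 : (CInfty Fq)⟦X⟧) = 0 := by simp [wp, twist_eq_twistHom]

theorem wp_one : wp (1 : (CInfty Fq)⟦X⟧) = 0 := by simp [wp, twist_eq_twistHom]

theorem IsLiSolution.mem_liSystem {k : ℕ} {Y : Fin k → (CInfty Fq)⟦X⟧}
    {L : Fin (k + 1) → (CInfty Fq)⟦X⟧} (hL : IsLiSolution Y L) : L ∈ liSystem Y :=
  ⟨by rw [hL.2.1, wp_one], hL.2.2⟩

theorem IsStarSolution.mem_starSystem {k : ℕ} {Y : Fin k → (CInfty Fq)⟦X⟧}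
    {S : Fin (k + 1) → (CInfty Fq)⟦X⟧} (hS : IsStarSolution Y S) : S ∈ starSystem Y :=
  ⟨by rw [hS.2.1, wp_one], hS.2.2⟩

theorem monodromyZero_le_liSystem {d : ℕ} (Y : Fin d → (CInfty Fq)⟦X⟧) :
    monodromyZero Y ≤ liSystem Y := by
  refine Submodule.span_le.2 ?_
  rintro _ ⟨k, hk, L, ⟨-, hL0, hL⟩, rfl⟩
  refine ⟨?_, fun i => ?_⟩
  · dsimp only
    split_ifs with h
    · have : (⟨((0 : Fin (d + 1)) : ℕ) - (d - k), by simp⟩ : Fin (k + 1)) = 0 := by ext; simp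
      rw [this, hL0, wp_one]
    · exact wp_zero
  · dsimp only
    simp only [Fin.val_succ, Fin.val_castSucc]
    -- The equation at `i` lies inside the zero padding, at its border (where the entry `1` follows
    -- a `0`), or among the equations of `L`.
    rcases lt_trichotomy ((i : ℕ) + 1) (d - k) with h | h | h
    · rw [dif_neg (by omega), dif_neg (by omega)]
      simp [wp, twist_eq_twistHom]
    · rw [dif_pos (by omega), dif_neg (by omega)]
      have : (⟨(i : ℕ) + 1 - (d - k), by omega⟩ : Fin (k + 1)) = 0 := by ext; simp; omega
      rw [this, hL0, wp_one]
      simp [twist_eq_twistHom]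
    · rw [dif_pos (by omega), dif_pos (by omega)]
      have h2 := hL ⟨(i : ℕ) - (d - k), by omega⟩
      have e1 : (⟨(i : ℕ) + 1 - (d - k), by omega⟩ : Fin (k + 1)) =
          Fin.succ ⟨(i : ℕ) - (d - k), by omega⟩ := by ext; simp; omega
      -- Reversal in `Fin k` matches reversal in `Fin d`: `k - 1 - (i - (d - k)) = d - 1 - i`.
      have e2 : Fin.castLE hk (Fin.rev ⟨(i : ℕ) - (d - k), by omega⟩) = i.rev := by
        ext; simp; omega
      simp only [e2] at h2
      rw [e1, h2]
      rfl

theorem monodromyZeroStar_le_starSystem {d : ℕ} (Y : Fin d → (CInfty Fq)⟦X⟧) :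
    monodromyZeroStar Y ≤ starSystem Y := by
  refine Submodule.span_le.2 ?_
  rintro _ ⟨k, hk, S, ⟨-, hS0, hS⟩, rfl⟩
  refine ⟨?_, fun i => ?_⟩
  · dsimp only
    split_ifs with h
    · have : (⟨((Fin.last d : Fin (d + 1)) : ℕ), by omega⟩ : Fin (k + 1)) = Fin.last k := by
        ext; simp at h ⊢; omega
      rw [this, hS0, wp_one]
    · exact wp_zero
  · dsimp only
    simp only [Fin.val_succ, Fin.val_castSucc]
    rcases lt_trichotomy (i : ℕ) k with h | h | h
    · rw [dif_pos (by omega), dif_pos (by omega)]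
      exact hS ⟨i, h⟩
    · rw [dif_pos (by omega), dif_neg (by omega)]
      have : (⟨(i : ℕ), by omega⟩ : Fin (k + 1)) = Fin.last k := by ext; simp [h]
      rw [this, hS0, wp_one, mul_zero]
    · rw [dif_neg (by omega), dif_neg (by omega), wp_zero, mul_zero]

/-- Monodromy involves all the `Y_i` but the last. The last one enters only the first equation,
where it multiplies the twist of the new entry `0`. -/
theorem cons_zero_mem_liSystem {d : ℕ} {Y : Fin (d + 1) → (CInfty Fq)⟦X⟧}
    {V : Fin (d + 1) → (CInfty Fq)⟦X⟧} (hV : V ∈ liSystem fun i => Y i.castSucc) :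
    (Fin.cons (α := fun _ => (CInfty Fq)⟦X⟧) 0 V : Fin (d + 2) → (CInfty Fq)⟦X⟧) ∈ liSystem Y := by
  refine ⟨by simpa using wp_zero, fun i => ?_⟩
  rw [Fin.cons_succ]
  refine Fin.cases ?_ (fun j => ?_) i
  · rw [hV.1]
    simp [twist_eq_twistHom]
  · rw [← Fin.succ_castSucc, Fin.cons_succ, hV.2 j, Fin.rev_succ]

theorem snoc_zero_mem_starSystem {d : ℕ} {Y : Fin (d + 1) → (CInfty Fq)⟦X⟧}
    {W : Fin (d + 1) → (CInfty Fq)⟦X⟧} (hW : W ∈ starSystem fun i => Y i.castSucc) :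
    (Fin.snoc (α := fun _ => (CInfty Fq)⟦X⟧) W 0 : Fin (d + 2) → (CInfty Fq)⟦X⟧) ∈
      starSystem Y := by
  refine ⟨by simpa using wp_zero, fun i => ?_⟩
  rw [Fin.snoc_castSucc]
  refine Fin.lastCases ?_ (fun j => ?_) i
  · rw [hW.1]
    simp
  · rw [Fin.succ_castSucc, Fin.snoc_castSucc, hW.2 j]

/-- The alternating pairing of solutions of the two systems is fixed by the twist. -/
theorem twist_sum_mul_eq {k : ℕ} {Y : Fin k → (CInfty Fq)⟦X⟧} {V W : Fin (k + 1) → (CInfty Fq)⟦X⟧}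
    (hV : V ∈ liSystem Y) (hW : W ∈ starSystem fun i => Y i.rev) :
    twist (∑ j : Fin (k + 1), (-1) ^ (k - (j : ℕ)) * (W j * V j)) =
      ∑ j : Fin (k + 1), (-1) ^ (k - (j : ℕ)) * (W j * V j) := by
  obtain ⟨hV0, hV⟩ := hV
  obtain ⟨hW0, hW⟩ := hW
  simp only [wp, twist_eq_twistHom] at hV0 hV hW0 hW ⊢
  -- Both sides are compared with the mixed sum of the `W j * twistHom (V j)`: here the star system
  -- rewrites the twist of `W`, and in `hright` the other system rewrites `V`.
  have hleft : twistHom (∑ j : Fin (k + 1), (-1) ^ (k - (j : ℕ)) * (W j * V j)) =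
      ∑ j : Fin (k + 1), (-1) ^ (k - (j : ℕ)) * (W j * twistHom (V j)) -
        ∑ i : Fin k, (-1) ^ (k - (i : ℕ)) * (Y i.rev * W i.succ * twistHom (V i.castSucc)) := by
    simp only [map_sum, map_mul, map_pow, map_neg, map_one]
    rw [Fin.sum_univ_castSucc, Fin.sum_univ_castSucc, ← sub_eq_zero.1 hW0, add_sub_right_comm,
      ← Finset.sum_sub_distrib]
    congr 1
    refine Finset.sum_congr rfl fun i _ => ?_
    rw [Fin.val_castSucc]
    linear_combination -((-1) ^ (k - (i : ℕ)) * twistHom (V i.castSucc)) * hW i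
  have hright : ∑ j : Fin (k + 1), (-1) ^ (k - (j : ℕ)) * (W j * V j) =
      ∑ j : Fin (k + 1), (-1) ^ (k - (j : ℕ)) * (W j * twistHom (V j)) -
        ∑ i : Fin k, (-1) ^ (k - (i : ℕ)) * (Y i.rev * W i.succ * twistHom (V i.castSucc)) := by
    rw [Fin.sum_univ_succ, Fin.sum_univ_succ, ← sub_eq_zero.1 hV0, add_sub_assoc,
      ← Finset.sum_sub_distrib]
    congr 1
    refine Finset.sum_congr rfl fun i _ => ?_
    -- The shift from `i` to `i + 1` flips the sign, so that the two correction sums agree.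
    have hs : k - (i : ℕ) = k - ((i : ℕ) + 1) + 1 := by omega
    rw [Fin.val_succ, hs, pow_succ]
    linear_combination ((-1) ^ (k - ((i : ℕ) + 1)) * W i.succ) * hV i
  rw [hleft, hright]

end Systems

/-! ### Branch values as solutions of the systems. -/

section Branches

variable {Fq : Type*} [Field Fq] [Fintype Fq]

/-- The monodromy discrepancy is added to the chosen solution; its padding `0` sits at index `0`, so
the entry `1` there survives. -/
theorem IsBranch.exists_mem_liSystem {ξ : CInfty Fq} {d : ℕ} {n : Fin (d + 1) → ℕ}
    {Z : Fin d → tate Fq} {B : tate Fq →ₗ[Fq] (Fin (d + 1) → tate Fq)} (hB : IsBranch ξ n Z B)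
    (z : tate Fq) :
    ∃ V ∈ liSystem (fun i => Omega ξ ^ n i *
        ((Fin.snoc (α := fun _ => tate Fq) Z z i : tate Fq) : (CInfty Fq)⟦X⟧)),
      V 0 = 1 ∧ ∀ j, (B z j : (CInfty Fq)⟦X⟧) = (Omega ξ)⁻¹ ^ (∑ i, n i) * V j.succ := by
  obtain ⟨L, hL, hBL⟩ := hB z
  obtain ⟨m, hm, hm'⟩ := Submodule.mem_smul_pointwise_iff_exists _ _ _ |>.1 (SModEq.sub_mem.1 hBL)
  refine ⟨L + Fin.cons (α := fun _ => (CInfty Fq)⟦X⟧) 0 m,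
    add_mem hL.mem_liSystem (cons_zero_mem_liSystem ?_), by simp [hL.2.1], fun j => ?_⟩
  · simpa using monodromyZero_le_liSystem _ hm
  · have := congrFun hm' j
    simp only [Pi.smul_apply, Pi.sub_apply, smul_eq_mul] at this
    simp only [Pi.add_apply, Fin.cons_succ]
    linear_combination -this

theorem IsStarBranch.exists_mem_starSystem {ξ : CInfty Fq} {d : ℕ} {n : Fin (d + 1) → ℕ}
    {Z : Fin d → tate Fq} {B : tate Fq →ₗ[Fq] (Fin (d + 1) → tate Fq)} (hB : IsStarBranch ξ n Z B)
    (z : tate Fq) :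
    ∃ W ∈ starSystem (fun i => Omega ξ ^ n i *
        ((Fin.snoc (α := fun _ => tate Fq) Z z i : tate Fq) : (CInfty Fq)⟦X⟧)),
      W (Fin.last (d + 1)) = 1 ∧
        ∀ j, (B z j : (CInfty Fq)⟦X⟧) = (Omega ξ)⁻¹ ^ (∑ i, n i) * W j.castSucc := by
  obtain ⟨S, hS, hBS⟩ := hB z
  obtain ⟨m, hm, hm'⟩ := Submodule.mem_smul_pointwise_iff_exists _ _ _ |>.1 (SModEq.sub_mem.1 hBS)
  refine ⟨S + Fin.snoc (α := fun _ => (CInfty Fq)⟦X⟧) m 0,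
    add_mem hS.mem_starSystem (snoc_zero_mem_starSystem ?_), by simp [hS.2.1], fun j => ?_⟩
  · simpa using monodromyZeroStar_le_starSystem _ hm
  · have := congrFun hm' j
    simp only [Pi.smul_apply, Pi.sub_apply, smul_eq_mul] at this
    simp only [Pi.add_apply, Fin.snoc_castSucc]
    linear_combination -this

end Branches

end CarlitzMPL

theorem mainTheorem4 {Fq : Type*} [Field Fq] [Fintype Fq]
    (ξ : CInfty Fq) (hξ : ξ ^ (Fintype.card Fq - 1) = -theta Fq)
    {d : ℕ} (n : Fin (d + 1) → ℕ) (hn : ∀ i, 1 ≤ n i) (Z : Fin (d + 1) → tate Fq)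
    (B : tate Fq →ₗ[Fq] (Fin (d + 1) → tate Fq))
    (hB : IsBranch ξ n (fun i => Z i.castSucc) B)
    (Bstar : tate Fq →ₗ[Fq] (Fin (d + 1) → tate Fq))
    (hBstar : IsStarBranch ξ (fun i => n i.rev) (fun i => Z i.castSucc.rev) Bstar) :
    (Fin.snoc (α := fun _ => (CInfty Fq)⟦X⟧)
        (negateArgs (Bstar (Z 0))) ((Omega ξ)⁻¹ ^ (∑ i, n i)) :
          Fin (d + 2) → (CInfty Fq)⟦X⟧) ⬝ᵥ
      (Fin.cons (α := fun _ => (CInfty Fq)⟦X⟧)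
        ((Omega ξ)⁻¹ ^ (∑ i, n i)) (fun j => (B (Z (Fin.last d)) j : (CInfty Fq)⟦X⟧)) :
          Fin (d + 2) → (CInfty Fq)⟦X⟧)
      ≡ 0 [SMOD Submodule.span Fq⟦X⟧ {(Omega ξ)⁻¹ ^ (2 * ∑ i, n i)}] := by
  obtain ⟨V, hV, hV0, hBV⟩ := hB.exists_mem_liSystem (Z (Fin.last d))
  obtain ⟨W, hW, hW0, hBW⟩ := hBstar.exists_mem_starSystem (Z 0)
  -- Reversing the indices leaves the weight `N` unchanged, so both branches carry the same power of
  -- `Ω`.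
  have hsum : ∑ i : Fin (d + 1), n i.rev = ∑ i, n i := Equiv.sum_comp Fin.revPerm n
  rw [hsum] at hBW
  set ω := (Omega ξ)⁻¹ ^ (∑ i, n i) with hω
  have hZ (i : Fin (d + 1)) : (Fin.snoc (α := fun _ => tate Fq) (fun i => Z i.castSucc)
      (Z (Fin.last d)) i : tate Fq) = Z i := by
    refine Fin.lastCases ?_ (fun j => ?_) i <;> simp
  -- The star arguments are the full tuple `Z` reversed, the order that `twist_sum_mul_eq` requires.
  have hZstar (i : Fin (d + 1)) : (Fin.snoc (α := fun _ => tate Fq) (fun i => Z i.castSucc.rev)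
      (Z 0) i : tate Fq) = Z i.rev := by
    refine Fin.lastCases ?_ (fun j => ?_) i <;> simp
  simp only [hZ] at hV
  simp only [hZstar] at hW
  obtain ⟨g, hg⟩ := exists_algebraMap_eq_of_twist_eq (twist_sum_mul_eq hV hW)
  rw [SModEq.zero, Submodule.mem_span_singleton]
  refine ⟨g, ?_⟩
  rw [Algebra.smul_def, hg, two_mul, pow_add, ← hω, dotProduct, Finset.sum_mul]
  refine Finset.sum_congr rfl fun j _ => ?_
  -- The signs of `negateArgs` are those of the pairing with `k = d + 1`; at the last index the sign
  -- is `1` and `W` is `1`.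
  have h1 : (Fin.snoc (α := fun _ => (CInfty Fq)⟦X⟧) (negateArgs (Bstar (Z 0))) ω :
      Fin (d + 2) → (CInfty Fq)⟦X⟧) j = (-1) ^ (d + 1 - (j : ℕ)) * (ω * W j) := by
    refine Fin.lastCases ?_ (fun i => ?_) j
    · simp [hW0]
    · simp [negateArgs, hBW]
  have h2 : (Fin.cons (α := fun _ => (CInfty Fq)⟦X⟧) ω
      (fun j => (B (Z (Fin.last d)) j : (CInfty Fq)⟦X⟧)) : Fin (d + 2) → (CInfty Fq)⟦X⟧) j =
      ω * V j := by
    refine Fin.cases ?_ (fun i => ?_) j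
    · simp [hV0]
    · simp [hBV]
  rw [h1, h2]
  ring
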